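/- Let $N,d\in\mathbb N$, let $U\subset\mathbb R^N$ be open and bounded, and let $\mu$ be a finite $\mathbb R^d$-valued Radon measure on $U$, with total variation $|\mu|$ and Lebesgue decomposition $\mu=\mu_{ac}\,\mathcal L^N+\mu_s$, where $\mu_{ac}\in L^1(U;\mathbb R^d)$ and $|\mu_s|\perp\mathcal L^N$; put $\nu=\frac{d\mu_s}{d|\mu_s|}$. Let $\phi\in C^\infty(\mathbb R^N;[0,\infty))$ satisfy $\operatorname{supp}\phi\subset B(0,1)$ and $\int_{\mathbb R^N}\phi\,dx=1$, and for $\varepsilon>0$ put $\phi_\varepsilon(x)=\varepsilon^{-N}\phi(x/\varepsilon)$ and $$(\mu*\phi_\varepsilon)(x)=\int_U\phi_\varepsilon(x-y)\,d\mu(y),\qquad x\in\mathbb R^N.$$ Let $g:\mathbb R^d\to[0,\infty)$ be convex with $g(p)\le C(1+|p|)$ for all $p\in\mathbb R^d$ and some $C>0$, let $g^\infty(p)=\limsup_{t\to+\infty}\frac{g(tp)}{t}$ be its recession function, and suppose that there are $\alpha>1$ and $C>0$ such that $$\left|\frac{g(tp)}{t}-g^\infty(p)\right|\le\frac{C}{t^\alpha}\qquad\text{for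 all } p\in\mathbb R^d\text{ with }|p|=1\text{ and all }t>0.$$ Then for every $\Omega\subset\subset U$ (that is, $\overline\Omega$ is compact and contained in $U$) with $\mathcal L^N(\partial\Omega)=|\mu|(\partial\Omega)=0$, all the integrals below are finite and $$\lim_{\varepsilon\to0^+}\int_\Omega g(\mu*\phi_\varepsilon)\,dx=\int_\Omega g(\mu_{ac})\,dx+\int_\Omega g^\infty(\nu)\,d|\mu_s|.$$ -/

import Mathlib

open MeasureTheory Filter Topology
open scoped ContDiff

noncomputable section

namespace AreaStrict

/-- The recession function `g^∞(p) = limsup_{t → +∞} g(t p) / t`. -/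
def recession {d : ℕ} (g : EuclideanSpace ℝ (Fin d) → ℝ) (p : EuclideanSpace ℝ (Fin d)) : ℝ :=
  limsup (fun t : ℝ => g (t • p) / t) atTop

/-- The rescaled kernel `φ_ε(x) = ε^{-N} φ(x / ε)`. -/
def scaledKernel {N : ℕ} (φ : EuclideanSpace ℝ (Fin N) → ℝ) (ε : ℝ)
    (x : EuclideanSpace ℝ (Fin N)) : ℝ :=
  (ε ^ N)⁻¹ * φ (ε⁻¹ • x)

/-- Lebesgue measure on a subset `U` of `ℝ^N`, as a measure on the subtype. -/
def lebesgueOn {N : ℕ} (U : Set (EuclideanSpace ℝ (Fin N))) : Measure U :=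
  (volume : Measure (EuclideanSpace ℝ (Fin N))).comap (↑)

/-- The convolution `(μ * φ_ε)(x) = ∫_U φ_ε(x - y) dμ(y)` of an `ℝ^d`-valued measure `μ` on
`U ⊆ ℝ^N` with the rescaled kernel. -/
def mollify {N d : ℕ} {U : Set (EuclideanSpace ℝ (Fin N))}
    (μ : VectorMeasure U (EuclideanSpace ℝ (Fin d))) (φ : EuclideanSpace ℝ (Fin N) → ℝ) (ε : ℝ)
    (x : EuclideanSpace ℝ (Fin N)) : EuclideanSpace ℝ (Fin d) :=
  μ.integral (fun y : U => scaledKernel φ ε (x - y)) (ContinuousLinearMap.lsmul ℝ ℝ)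

/-- The `i`-th coordinate of an `ℝ^d`-valued measure, as a signed measure. -/
def component {X : Type*} [MeasurableSpace X] {d : ℕ}
    (μ : VectorMeasure X (EuclideanSpace ℝ (Fin d))) (i : Fin d) : SignedMeasure X :=
  μ.mapRange (EuclideanSpace.proj (𝕜 := ℝ) i).toLinearMap.toAddMonoidHom
    (EuclideanSpace.proj (𝕜 := ℝ) i).continuous

theorem component_apply {X : Type*} [MeasurableSpace X] {d : ℕ}
    (μ : VectorMeasure X (EuclideanSpace ℝ (Fin d))) (i : Fin d) (s : Set X) :
    component μ i s = μ s i :=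
  rfl

/-- The Radon-Nikodym derivative `dμ/dκ` of (the absolutely continuous part of) an `ℝ^d`-valued
measure `μ` with respect to a positive measure `κ`, taken coordinate by coordinate. -/
def density {X : Type*} [MeasurableSpace X] {d : ℕ}
    (μ : VectorMeasure X (EuclideanSpace ℝ (Fin d))) (κ : Measure X) (x : X) :
    EuclideanSpace ℝ (Fin d) :=
  WithLp.toLp 2 fun i => (component μ i).rnDeriv κ x

/-- The singular part `μ_s = μ - μ_ac κ` of `μ` with respect to `κ`. -/
def singularPart {X : Type*} [MeasurableSpace X] {d : ℕ}
    (μ : VectorMeasure X (EuclideanSpace ℝ (Fin d))) (κ : Measure X) :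
    VectorMeasure X (EuclideanSpace ℝ (Fin d)) :=
  μ - κ.withDensityᵥ (density μ κ)

/-- The polar density `ν = dμ/d|μ|` of an `ℝ^d`-valued measure with respect to its total
variation measure. -/
def polar {X : Type*} [MeasurableSpace X] {d : ℕ}
    (μ : VectorMeasure X (EuclideanSpace ℝ (Fin d))) (x : X) : EuclideanSpace ℝ (Fin d) :=
  density μ μ.variation x

end AreaStrict

end

/-!
Continuity of `∫_Ω g(μ * φ_ε) dx` as `ε → 0`, without Lebesgue points or lower semicontinuity.

Write `σ = 1_U dx + |μ_s|`, so that `μ = h σ` with `h = μ_ac` Lebesgue-almost everywhere and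
`h = ν` almost everywhere for `|μ_s|`. A convex function of linear growth is Lipschitz, hence so is
`g^∞`, and both `h ↦ ∫_Ω g(h) dx + ∫_Ω g^∞(h) d|μ_s|` and, uniformly in `ε`,
`h ↦ ∫_Ω g((h σ) * φ_ε) dx` are Lipschitz for the `L¹(σ)` norm. So `h` may be replaced by a
continuous, compactly supported `k`. For such `k` the convolution `(k σ) * φ_ε` is, at `x ∈ Ω` and
for small `ε`, uniformly close to `(1 + s_ε(x)) k(x)` relative to its mass, where
`s_ε = |μ_s| * φ_ε`.

The rate assumption on `g` together with the Lipschitz bound makes `g - g^∞` bounded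
(`exists_abs_sub_recession_le`), so
`|g((1 + t) p) - g(p) - t g^∞(p)| ≤ C min(1, t)` for bounded `p` (`abs_increment_sub_le`). Since
`|μ_s|` is singular, `∫ min(1, s_ε) dx → 0` (`tendsto_lintegral_min_one`), and what is left is
`∫_Ω g(k) dx + ∫_Ω s_ε g^∞(k) dx`, which converges because `|μ_s|` does not charge `∂Ω`
(`tendsto_integral_mollify_mul`). The two errors are put together in
`tendsto_setIntegral_mollify`, on `ℝ^N` and for a positive measure with a density; the rest is the
polar decomposition of vector measures and the passage from `U` to `ℝ^N`.
-/

open scoped ENNReal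

/-! ### Recession functions of convex functions of linear growth -/

/-- To compare `g y` with `g x`, use convexity on the segment from `x` through `y` to a point at
distance `t * dist x y`, and let `t → ∞`; nonnegativity disposes of the weight of `g x`. -/
theorem ConvexOn.lipschitzWith_of_linear_growth {F : Type*} [NormedAddCommGroup F]
    [NormedSpace ℝ F] {g : F → ℝ} (hg : ConvexOn ℝ Set.univ g) (hg0 : ∀ p, 0 ≤ g p) {C : NNReal}
    (hC : ∀ p, g p ≤ C * (1 + ‖p‖)) : LipschitzWith C g := by
  refine LipschitzWith.of_le_add_mul C fun y x => ?_
  have key : ∀ t : ℝ, 1 ≤ t → g y ≤ g x + C * ((1 + ‖x‖) / t + dist y x) := by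
    intro t ht
    have ht0 : 0 < t := by linarith
    have hinv : t⁻¹ ≤ 1 := inv_le_one_of_one_le₀ ht
    have h := hg.2 (Set.mem_univ x) (Set.mem_univ (x + t • (y - x)))
      (sub_nonneg.2 hinv) (inv_nonneg.2 ht0.le) (by ring)
    have e : (1 - t⁻¹) • x + t⁻¹ • (x + t • (y - x)) = y := by
      rw [smul_add, smul_smul, inv_mul_cancel₀ ht0.ne', sub_smul, one_smul, one_smul]
      abel
    rw [e] at h
    have h2 := hC (x + t • (y - x))
    have h3 : ‖x + t • (y - x)‖ ≤ ‖x‖ + t * dist y x := by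
      refine (norm_add_le _ _).trans ?_
      rw [norm_smul, Real.norm_of_nonneg ht0.le, dist_eq_norm]
    have h4 : g (x + t • (y - x)) ≤ C * (1 + (‖x‖ + t * dist y x)) := h2.trans (by gcongr)
    have h5 : t⁻¹ * g (x + t • (y - x)) ≤ C * ((1 + ‖x‖) / t + dist y x) := by
      calc t⁻¹ * g (x + t • (y - x)) ≤ t⁻¹ * (C * (1 + (‖x‖ + t * dist y x))) := by gcongr
        _ = _ := by field_simp; ring
    simp only [smul_eq_mul] at h
    nlinarith [hg0 x, inv_pos.2 ht0]
  have hlim : Tendsto (fun t : ℝ => g x + C * ((1 + ‖x‖) / t + dist y x)) atTop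
      (𝓝 (g x + C * (0 + dist y x))) :=
    (((tendsto_const_nhds.div_atTop tendsto_id).add_const _).const_mul _).const_add _
  have := ge_of_tendsto hlim (eventually_atTop.2 ⟨1, key⟩)
  simpa using this

namespace AreaStrict

section Recession

variable {d : ℕ} {g : EuclideanSpace ℝ (Fin d) → ℝ}

/-- The `limsup` in the definition of the recession function is a limit. -/
theorem tendsto_recession
    (hg : ∃ α : ℝ, 1 < α ∧ ∃ C : ℝ, 0 < C ∧
      ∀ p : EuclideanSpace ℝ (Fin d), ‖p‖ = 1 → ∀ t : ℝ, 0 < t →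
        |g (t • p) / t - recession g p| ≤ C / t ^ α) (p : EuclideanSpace ℝ (Fin d)) :
    Tendsto (fun t : ℝ => g (t • p) / t) atTop (𝓝 (recession g p)) := by
  obtain ⟨α, hα, C, hC, h⟩ := hg
  suffices H : ∃ l, Tendsto (fun t : ℝ => g (t • p) / t) atTop (𝓝 l) by
    obtain ⟨l, hl⟩ := H
    have : recession g p = l := hl.limsup_eq
    rwa [this]
  rcases eq_or_ne p 0 with rfl | hp
  · exact ⟨0, by simpa using tendsto_const_nhds.div_atTop tendsto_id⟩
  have hp' : 0 < ‖p‖ := norm_pos_iff.2 hp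
  set q := ‖p‖⁻¹ • p with hq
  have hq1 : ‖q‖ = 1 := by rw [hq, norm_smul, norm_inv, norm_norm, inv_mul_cancel₀ hp'.ne']
  have hpq : p = ‖p‖ • q := by rw [hq, smul_smul, mul_inv_cancel₀ hp'.ne', one_smul]
  have h1 : Tendsto (fun t : ℝ => g (t • q) / t) atTop (𝓝 (recession g q)) := by
    rw [tendsto_iff_dist_tendsto_zero]
    have hlim : Tendsto (fun t : ℝ => C / t ^ α) atTop (𝓝 0) :=
      tendsto_const_nhds.div_atTop (tendsto_rpow_atTop (by linarith))
    refine squeeze_zero' (Eventually.of_forall fun _ => dist_nonneg)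
      (eventually_atTop.2 ⟨1, fun t ht => ?_⟩) hlim
    exact h q hq1 t (by linarith)
  refine ⟨‖p‖ * recession g q, ?_⟩
  have h2 := (h1.comp (tendsto_id.atTop_mul_const hp')).const_mul ‖p‖
  refine h2.congr fun t => ?_
  have : (t * ‖p‖) • q = t • p := by rw [mul_smul, ← hpq]
  simp only [Function.comp, id, this]
  field_simp

theorem recession_smul
    (hg : ∀ p, Tendsto (fun t : ℝ => g (t • p) / t) atTop (𝓝 (recession g p)))
    {r : ℝ} (hr : 0 ≤ r) (p : EuclideanSpace ℝ (Fin d)) :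
    recession g (r • p) = r * recession g p := by
  rcases hr.eq_or_lt with rfl | hr
  · have h := hg 0
    simp only [smul_zero] at h
    simpa using tendsto_nhds_unique h (tendsto_const_nhds.div_atTop tendsto_id)
  refine tendsto_nhds_unique (hg (r • p)) ?_
  refine (((hg p).comp (tendsto_id.atTop_mul_const hr)).const_mul r).congr fun t => ?_
  simp only [Function.comp, id, mul_smul]
  field_simp

theorem lipschitzWith_recession
    (hg : ∀ p, Tendsto (fun t : ℝ => g (t • p) / t) atTop (𝓝 (recession g p)))
    {K : NNReal} (hK : LipschitzWith K g) : LipschitzWith K (recession g) := by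
  refine LipschitzWith.of_dist_le_mul fun p q => ?_
  refine le_of_tendsto ((hg p).dist (hg q)) (eventually_atTop.2 ⟨1, fun t ht => ?_⟩)
  have ht0 : 0 < t := by linarith
  have h := hK.dist_le_mul (t • p) (t • q)
  rw [dist_smul₀, Real.norm_of_nonneg ht0.le] at h
  rw [Real.dist_eq, ← sub_div, abs_div, abs_of_pos ht0, div_le_iff₀ ht0, ← Real.dist_eq]
  linarith

/-- The rate of convergence at infinity and the Lipschitz bound near `0` together make `g - g^∞`
bounded on the whole space. -/
theorem exists_abs_sub_recession_le
    (hg : ∃ α : ℝ, 1 < α ∧ ∃ C : ℝ, 0 < C ∧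
      ∀ p : EuclideanSpace ℝ (Fin d), ‖p‖ = 1 → ∀ t : ℝ, 0 < t →
        |g (t • p) / t - recession g p| ≤ C / t ^ α)
    {K : NNReal} (hK : LipschitzWith K g) :
    ∃ M : ℝ, ∀ p, |g p - recession g p| ≤ M := by
  have hlim := tendsto_recession hg
  have hK' := lipschitzWith_recession hlim hK
  have h0 : recession g 0 = 0 := by
    simpa using recession_smul hlim le_rfl (0 : EuclideanSpace ℝ (Fin d))
  obtain ⟨α, hα, C, hC, h⟩ := hg
  refine ⟨max C (|g 0| + 2 * K), fun p => ?_⟩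
  rcases le_total 1 ‖p‖ with hp | hp
  · refine le_max_of_le_left ?_
    have hp' : 0 < ‖p‖ := by linarith
    have hpq : ‖p‖ • (‖p‖⁻¹ • p) = p := by rw [smul_smul, mul_inv_cancel₀ hp'.ne', one_smul]
    have h1 := h (‖p‖⁻¹ • p) (by rw [norm_smul, norm_inv, norm_norm, inv_mul_cancel₀ hp'.ne'])
      ‖p‖ hp'
    have h2 : recession g p = ‖p‖ * recession g (‖p‖⁻¹ • p) := by
      rw [← recession_smul hlim hp'.le, hpq]
    rw [hpq] at h1
    have h3 : g p - recession g p = ‖p‖ * (g p / ‖p‖ - recession g (‖p‖⁻¹ • p)) := by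
      rw [h2]; field_simp
    rw [h3, abs_mul, abs_of_pos hp']
    have h4 : ‖p‖ ≤ ‖p‖ ^ α := by
      simpa using Real.rpow_le_rpow_of_exponent_le hp hα.le
    calc ‖p‖ * |g p / ‖p‖ - recession g (‖p‖⁻¹ • p)| ≤ ‖p‖ * (C / ‖p‖ ^ α) := by gcongr
      _ ≤ ‖p‖ ^ α * (C / ‖p‖ ^ α) := by gcongr
      _ = C := by field_simp
  · refine le_max_of_le_right ?_
    have h1 := hK.dist_le_mul p 0
    have h2 := hK'.dist_le_mul p 0
    rw [dist_zero_right, Real.dist_eq] at h1 h2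
    rw [h0, sub_zero] at h2
    have h3 : (K : ℝ) * ‖p‖ ≤ K := mul_le_of_le_one_right K.2 hp
    calc |g p - recession g p| = |(g p - g 0) + g 0 - recession g p| := by ring_nf
      _ ≤ |(g p - g 0) + g 0| + |recession g p| := abs_sub _ _
      _ ≤ |g p - g 0| + |g 0| + |recession g p| := by gcongr; exact abs_add_le _ _
      _ ≤ |g 0| + 2 * K := by linarith

end Recession

end AreaStrict

/-! ### Lebesgue and polar decomposition of vector measures -/

namespace AreaStrict

section Vector

variable {X : Type*} [MeasurableSpace X] {d : ℕ}

theorem variation_le_sum_component (μ : VectorMeasure X (EuclideanSpace ℝ (Fin d))) :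
    μ.variation ≤ ∑ i, (component μ i).totalVariation := by
  refine VectorMeasure.variation_le_of_forall_enorm_le fun E hE => ?_
  rw [Measure.finsetSum_apply]
  have h1 : ‖μ E‖ₑ ≤ ∑ i, ‖μ E i‖ₑ := by
    have h2 : μ E = ∑ i, EuclideanSpace.single i (μ E i) := by
      ext j
      simp [Finset.sum_apply]
    calc ‖μ E‖ₑ = ‖∑ i, EuclideanSpace.single i (μ E i)‖ₑ := by rw [← h2]
      _ ≤ ∑ i, ‖EuclideanSpace.single i (μ E i)‖ₑ := enorm_sum_le _ _
      _ = ∑ i, ‖μ E i‖ₑ := by simp [enorm_eq_nnnorm]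
  refine h1.trans (Finset.sum_le_sum fun i _ => ?_)
  exact (component μ i).enorm_le_totalVariation E

/-- Finite-dimensional vector measures have finite variation. -/
theorem isFiniteMeasure_variation (μ : VectorMeasure X (EuclideanSpace ℝ (Fin d))) :
    IsFiniteMeasure μ.variation :=
  isFiniteMeasure_of_le _ (variation_le_sum_component μ)

theorem integrable_density (μ : VectorMeasure X (EuclideanSpace ℝ (Fin d))) (κ : Measure X) :
    Integrable (density μ κ) κ :=
  Integrable.of_eval_piLp fun i => SignedMeasure.integrable_rnDeriv (component μ i) κ

theorem component_withDensityᵥ {κ : Measure X} {f : X → EuclideanSpace ℝ (Fin d)}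
    (hf : Integrable f κ) (i : Fin d) :
    component (κ.withDensityᵥ f) i = κ.withDensityᵥ fun x => f x i := by
  ext E hE
  rw [component_apply, withDensityᵥ_apply hf hE, withDensityᵥ_apply (hf.eval_piLp i) hE]
  exact (eval_integral_piLp (fun i => (hf.eval_piLp i).integrableOn) i)

theorem component_singularPart (μ : VectorMeasure X (EuclideanSpace ℝ (Fin d))) (κ : Measure X)
    [SigmaFinite κ] (i : Fin d) :
    component (singularPart μ κ) i = (component μ i).singularPart κ := by
  have h := (component μ i).singularPart_add_withDensity_rnDeriv_eq (μ := κ)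
  have h2 : component (singularPart μ κ) i =
      component μ i - component (κ.withDensityᵥ (density μ κ)) i := rfl
  rw [h2, component_withDensityᵥ (integrable_density μ κ)]
  exact sub_eq_of_eq_add h.symm

theorem variation_singularPart_mutuallySingular
    (μ : VectorMeasure X (EuclideanSpace ℝ (Fin d))) (κ : Measure X) [SigmaFinite κ] :
    (singularPart μ κ).variation ⟂ₘ κ := by
  refine Measure.MutuallySingular.mono_ac ?_
    (Measure.absolutelyContinuous_of_le (variation_le_sum_component _))
    Measure.AbsolutelyContinuous.rfl
  rw [← Measure.sum_fintype, Measure.MutuallySingular.sum_left]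
  intro i
  rw [component_singularPart, SignedMeasure.singularPart_totalVariation]
  exact (Measure.mutuallySingular_singularPart _ _).add_left
    (Measure.mutuallySingular_singularPart _ _)

/-- The polar decomposition `μ = ν |μ|`. -/
theorem variation_withDensityᵥ_polar (μ : VectorMeasure X (EuclideanSpace ℝ (Fin d))) :
    μ.variation.withDensityᵥ (polar μ) = μ := by
  have := isFiniteMeasure_variation μ
  have hi : Integrable (polar μ) μ.variation := integrable_density μ μ.variation
  have key : ∀ i, component (μ.variation.withDensityᵥ (polar μ)) i = component μ i := by
    intro i
    rw [component_withDensityᵥ hi]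
    refine SignedMeasure.withDensityᵥ_rnDeriv_eq (component μ i) μ.variation ?_
    refine VectorMeasure.AbsolutelyContinuous.mk fun E hE h0 => ?_
    rw [Measure.toENNRealVectorMeasure_apply_measurable hE] at h0
    have : μ E = 0 := by
      rw [← enorm_eq_zero, ← le_zero_iff, ← h0]
      exact VectorMeasure.enorm_measure_le_variation μ E
    rw [component_apply, this]; rfl
  ext E hE i
  exact DFunLike.congr_fun (key i) E

theorem withDensityᵥ_density_add_singularPart
    (μ : VectorMeasure X (EuclideanSpace ℝ (Fin d))) (κ : Measure X) :
    κ.withDensityᵥ (density μ κ) + singularPart μ κ = μ := by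
  simp [singularPart]

theorem variation_singularPart_eq_zero {μ : VectorMeasure X (EuclideanSpace ℝ (Fin d))}
    {κ : Measure X} {s : Set X} (hs : MeasurableSet s) (hμ : μ.variation s = 0) (hκ : κ s = 0) :
    (singularPart μ κ).variation s = 0 := by
  rw [VectorMeasure.variation_apply_eq_zero hs] at hμ ⊢
  intro t hts ht
  have h1 : singularPart μ κ t = μ t - κ.withDensityᵥ (density μ κ) t := rfl
  rw [h1, hμ t hts ht, withDensityᵥ_apply (integrable_density μ κ) ht,
    Measure.restrict_eq_zero.2 (measure_mono_null hts hκ)]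
  simp

/-- The density of `μ` with respect to `κ + |μ_s|`: off a `κ`-null set carrying `μ_s` it is
`μ_ac`, on that set it is `ν`. -/
theorem exists_density_add_variation_singularPart
    (μ : VectorMeasure X (EuclideanSpace ℝ (Fin d))) (κ : Measure X) [SigmaFinite κ] :
    ∃ h : X → EuclideanSpace ℝ (Fin d),
      Integrable h (κ + (singularPart μ κ).variation) ∧ h =ᵐ[κ] density μ κ ∧
      h =ᵐ[(singularPart μ κ).variation] polar (singularPart μ κ) ∧
      (κ + (singularPart μ κ).variation).withDensityᵥ h = μ := by
  obtain ⟨A, hA, hsA, hκA⟩ := variation_singularPart_mutuallySingular μ κ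
  classical
  have h1 : A.piecewise (density μ κ) (polar (singularPart μ κ)) =ᵐ[κ] density μ κ := by
    filter_upwards [measure_eq_zero_iff_ae_notMem.1 hκA] with x hx
    exact Set.piecewise_eq_of_mem _ _ _ (not_not.1 hx)
  have h2 : A.piecewise (density μ κ) (polar (singularPart μ κ))
      =ᵐ[(singularPart μ κ).variation] polar (singularPart μ κ) := by
    filter_upwards [measure_eq_zero_iff_ae_notMem.1 hsA] with x hx
    exact Set.piecewise_eq_of_notMem _ _ _ hx
  have i1 := (integrable_density μ κ).congr h1.symm
  have i4 : Integrable (polar (singularPart μ κ)) (singularPart μ κ).variation :=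
    integrable_density _ _
  have i2 := i4.congr h2.symm
  have i3 := i1.add_measure i2
  refine ⟨_, i3, h1, h2, ?_⟩
  conv_rhs => rw [← withDensityᵥ_density_add_singularPart μ κ,
    ← variation_withDensityᵥ_polar (singularPart μ κ)]
  ext1 E hE
  rw [_root_.add_apply, withDensityᵥ_apply i3 hE, Measure.restrict_add,
    integral_add_measure i1.integrableOn i2.integrableOn,
    withDensityᵥ_apply (integrable_density μ κ) hE, withDensityᵥ_apply i4 hE,
    integral_congr_ae (ae_restrict_of_ae h1), integral_congr_ae (ae_restrict_of_ae h2)]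

end Vector

theorem integral_simpleFunc_withDensityᵥ {X F : Type*} [MeasurableSpace X] [NormedAddCommGroup F]
    [NormedSpace ℝ F] [CompleteSpace F] {κ : Measure X} {ρ : X → F}
    (hρ : Integrable ρ κ) [IsFiniteMeasure (κ.withDensityᵥ ρ).variation] (f : SimpleFunc X ℝ) :
    (κ.withDensityᵥ ρ).integral f (ContinuousLinearMap.lsmul ℝ ℝ) = ∫ x, f x • ρ x ∂κ := by
  have hint : ∀ f : SimpleFunc X ℝ, Integrable (fun x => f x • ρ x) κ := by
    intro f
    obtain ⟨C, hC⟩ := f.exists_forall_norm_le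
    exact hρ.bdd_smul C f.stronglyMeasurable.aestronglyMeasurable (Eventually.of_forall hC)
  induction f using SimpleFunc.induction with
  | const c hs =>
    rename_i s
    have h1 : ⇑(SimpleFunc.piecewise s hs (SimpleFunc.const X c) (SimpleFunc.const X 0)) =
        s.indicator fun _ => c := by
      ext x
      simp [Set.indicator, Set.piecewise]
    rw [h1]
    have h2 : (fun x => (s.indicator (fun _ => c) x) • ρ x) = s.indicator fun x => c • ρ x := by
      ext x
      by_cases hx : x ∈ s <;> simp [hx]
    rw [h2, integral_indicator hs, integral_smul, ← withDensityᵥ_apply hρ hs,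
      VectorMeasure.integral_indicator hs, VectorMeasure.integral_const,
      VectorMeasure.restrict_apply _ hs MeasurableSet.univ, Set.univ_inter]
    rfl
  | add _ hf hg =>
    rename_i f g hd
    rw [SimpleFunc.coe_add, VectorMeasure.integral_add (SimpleFunc.integrable_of_isFiniteMeasure f)
      (SimpleFunc.integrable_of_isFiniteMeasure g), hf, hg, ← integral_add (hint f) (hint g)]
    simp [add_smul]

/-- Integrating a bounded scalar function against a vector measure with a density. -/
theorem integral_withDensityᵥ {X F : Type*} [MeasurableSpace X] [NormedAddCommGroup F]
    [NormedSpace ℝ F] [CompleteSpace F] {κ : Measure X} {ρ : X → F}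
    (hρ : Integrable ρ κ) {f : X → ℝ} (hf : StronglyMeasurable f) {C : ℝ} (hC : ∀ x, ‖f x‖ ≤ C) :
    (κ.withDensityᵥ ρ).integral f (ContinuousLinearMap.lsmul ℝ ℝ) = ∫ x, f x • ρ x ∂κ := by
  have : IsFiniteMeasure (κ.withDensityᵥ ρ).variation := by
    rw [Measure.variation_withDensityᵥ hρ]
    exact isFiniteMeasure_withDensity hρ.2.ne
  rcases isEmpty_or_nonempty X with hX | ⟨⟨x₀⟩⟩
  · rw [VectorMeasure.integral_of_isEmpty, integral_of_isEmpty]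
  have hC0 : 0 ≤ C := (norm_nonneg _).trans (hC x₀)
  have h1 : Tendsto (fun n => (κ.withDensityᵥ ρ).integral (hf.approxBounded C n)
      (ContinuousLinearMap.lsmul ℝ ℝ)) atTop
      (𝓝 ((κ.withDensityᵥ ρ).integral f (ContinuousLinearMap.lsmul ℝ ℝ))) := by
    refine VectorMeasure.tendsto_integral_of_dominated_convergence (fun _ => C)
      (fun n => (hf.approxBounded C n).stronglyMeasurable.aestronglyMeasurable)
      (integrable_const C) (fun n => Eventually.of_forall fun x => hf.norm_approxBounded_le hC0 n x)
      (Eventually.of_forall fun x => hf.tendsto_approxBounded_of_norm_le (hC x))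
  have h2 : Tendsto (fun n => ∫ x, hf.approxBounded C n x • ρ x ∂κ) atTop
      (𝓝 (∫ x, f x • ρ x ∂κ)) := by
    refine tendsto_integral_of_dominated_convergence (fun x => C * ‖ρ x‖)
      (fun n => (hf.approxBounded C n).stronglyMeasurable.aestronglyMeasurable.smul hρ.1)
      (hρ.norm.const_mul C) (fun n => Eventually.of_forall fun x => ?_)
      (Eventually.of_forall fun x => (hf.tendsto_approxBounded_of_norm_le (hC x)).smul_const _)
    rw [norm_smul]
    gcongr
    exact hf.norm_approxBounded_le hC0 n x
  simp only [integral_simpleFunc_withDensityᵥ hρ] at h1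
  exact tendsto_nhds_unique h1 h2

end AreaStrict

/-! ### Mollification of positive measures -/

namespace AreaStrict

/-- A continuous probability density supported in the ball of radius `ε` about the origin. -/
structure IsMollifier {N : ℕ} (ρ : EuclideanSpace ℝ (Fin N) → ℝ) (ε : ℝ) : Prop where
  continuous : Continuous ρ
  nonneg : ∀ x, 0 ≤ ρ x
  eq_zero : ∀ x, ε ≤ ‖x‖ → ρ x = 0
  integral_eq_one : ∫ x, ρ x = 1

namespace IsMollifier

variable {N : ℕ} {ρ : EuclideanSpace ℝ (Fin N) → ℝ} {ε : ℝ}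

theorem hasCompactSupport (h : IsMollifier ρ ε) : HasCompactSupport ρ := by
  refine HasCompactSupport.intro (isCompact_closedBall 0 ε) fun x hx => h.eq_zero x ?_
  simpa using (not_le.1 (by simpa using hx)).le

theorem integrable (h : IsMollifier ρ ε) : Integrable ρ :=
  h.continuous.integrable_of_hasCompactSupport h.hasCompactSupport

theorem exists_bound (h : IsMollifier ρ ε) : ∃ C, ∀ x, ‖ρ x‖ ≤ C :=
  h.continuous.bounded_above_of_compact_support h.hasCompactSupport

theorem lintegral_eq_one (h : IsMollifier ρ ε) : ∫⁻ x, ENNReal.ofReal (ρ x) = 1 := by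
  rw [← ofReal_integral_eq_lintegral_ofReal h.integrable (Eventually.of_forall h.nonneg),
    h.integral_eq_one, ENNReal.ofReal_one]

theorem lintegral_sub_right (h : IsMollifier ρ ε) (y : EuclideanSpace ℝ (Fin N)) :
    ∫⁻ x, ENNReal.ofReal (ρ (x - y)) = 1 := by
  rw [lintegral_sub_right_eq_self fun x => ENNReal.ofReal (ρ x), h.lintegral_eq_one]

theorem integral_sub_right (h : IsMollifier ρ ε) (y : EuclideanSpace ℝ (Fin N)) :
    ∫ x, ρ (x - y) = 1 := by
  rw [integral_sub_right_eq_self ρ, h.integral_eq_one]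

theorem integral_sub_left (h : IsMollifier ρ ε) (x : EuclideanSpace ℝ (Fin N)) :
    ∫ y, ρ (x - y) = 1 := by
  rw [integral_sub_left_eq_self ρ, h.integral_eq_one]

theorem measurable_uncurry (h : IsMollifier ρ ε) :
    Measurable (Function.uncurry fun x y => ENNReal.ofReal (ρ (x - y))) :=
  (h.continuous.measurable.comp (measurable_fst.sub measurable_snd)).ennreal_ofReal

/-- Mollification preserves mass. -/
theorem lintegral_lintegral (h : IsMollifier ρ ε) (κ : Measure (EuclideanSpace ℝ (Fin N)))
    [SFinite κ] {w : EuclideanSpace ℝ (Fin N) → ℝ≥0∞} (hw : AEMeasurable w κ) :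
    ∫⁻ x, ∫⁻ y, ENNReal.ofReal (ρ (x - y)) * w y ∂κ = ∫⁻ y, w y ∂κ := by
  rw [lintegral_lintegral_swap]
  · refine lintegral_congr fun y => ?_
    rw [lintegral_mul_const'' _ ?_, h.lintegral_sub_right, one_mul]
    exact (h.measurable_uncurry.comp (measurable_id.prodMk measurable_const)).aemeasurable
  · exact h.measurable_uncurry.aemeasurable.mul hw.comp_snd

theorem integrable_sub_left (h : IsMollifier ρ ε) (κ : Measure (EuclideanSpace ℝ (Fin N)))
    [IsFiniteMeasure κ] (x : EuclideanSpace ℝ (Fin N)) : Integrable (fun y => ρ (x - y)) κ := by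
  obtain ⟨C, hC⟩ := h.exists_bound
  exact Integrable.of_bound
    (h.continuous.comp (continuous_const.sub continuous_id)).aestronglyMeasurable C
    (Eventually.of_forall fun y => hC _)

theorem integrable_smul (h : IsMollifier ρ ε) {F : Type*} [NormedAddCommGroup F]
    [NormedSpace ℝ F] {κ : Measure (EuclideanSpace ℝ (Fin N))}
    {f : EuclideanSpace ℝ (Fin N) → F} (hf : Integrable f κ) (x : EuclideanSpace ℝ (Fin N)) :
    Integrable (fun y => ρ (x - y) • f y) κ := by
  obtain ⟨C, hC⟩ := h.exists_bound
  exact hf.bdd_smul C (h.continuous.comp (continuous_const.sub continuous_id)).aestronglyMeasurable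
    (Eventually.of_forall fun y => hC _)

theorem continuous_convolution (h : IsMollifier ρ ε) {F : Type*} [NormedAddCommGroup F]
    [NormedSpace ℝ F] {κ : Measure (EuclideanSpace ℝ (Fin N))}
    {f : EuclideanSpace ℝ (Fin N) → F} (hf : Integrable f κ) :
    Continuous fun x => ∫ y, ρ (x - y) • f y ∂κ := by
  obtain ⟨C, hC⟩ := h.exists_bound
  refine continuous_of_dominated (bound := fun y => C * ‖f y‖)
    (fun x => (h.integrable_smul hf x).1) (fun x => Eventually.of_forall fun y => ?_)
    (hf.norm.const_mul C) (Eventually.of_forall fun y => ?_)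
  · rw [norm_smul]
    gcongr
    exact hC _
  · exact (h.continuous.comp (continuous_id.sub continuous_const)).smul continuous_const

theorem ofReal_integral (h : IsMollifier ρ ε) (κ : Measure (EuclideanSpace ℝ (Fin N)))
    [IsFiniteMeasure κ] (x : EuclideanSpace ℝ (Fin N)) :
    ENNReal.ofReal (∫ y, ρ (x - y) ∂κ) = ∫⁻ y, ENNReal.ofReal (ρ (x - y)) ∂κ :=
  ofReal_integral_eq_lintegral_ofReal (h.integrable_sub_left κ x)
    (Eventually.of_forall fun _ => h.nonneg _)

end IsMollifier

section Limits

variable {N : ℕ} {ρ : ℝ → EuclideanSpace ℝ (Fin N) → ℝ}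
  {s : Measure (EuclideanSpace ℝ (Fin N))} [IsFiniteMeasure s]

/-- The mollifications of a singular measure tend to `0` in measure. The measure is carried up to
a small mass by a Lebesgue-null compact set `K`; the mollification of `s` restricted to `K` lives
on a neighbourhood of `K` of small volume, and that of the rest has small mass. -/
theorem tendsto_lintegral_min_one (hρ : ∀ ε, 0 < ε → IsMollifier (ρ ε) ε) (hs : s ⟂ₘ volume) :
    Tendsto (fun ε => ∫⁻ x, min 1 (∫⁻ y, ENNReal.ofReal (ρ ε (x - y)) ∂s)) (𝓝[>] 0) (𝓝 0) := by
  rw [ENNReal.tendsto_nhds_zero]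
  intro δ hδ
  obtain ⟨A, hA, hsA, hvA⟩ := hs
  have hδ2 : δ / 2 ≠ 0 := (ENNReal.half_pos hδ.ne').ne'
  obtain ⟨K, hKA, hK, hKs⟩ := hA.compl.exists_isCompact_sdiff_lt (measure_ne_top s _) hδ2
  have hsK : s Kᶜ ≤ δ / 2 := by
    calc s Kᶜ ≤ s (Aᶜ \ K ∪ A) := measure_mono fun x hx => by
          by_cases h : x ∈ A
          · exact Or.inr h
          · exact Or.inl ⟨h, hx⟩
      _ ≤ s (Aᶜ \ K) + s A := measure_union_le _ _
      _ ≤ δ / 2 := by rw [hsA, add_zero]; exact hKs.le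
  have hKv : Tendsto (fun r => volume (Metric.cthickening r K)) (𝓝[>] 0) (𝓝 0) := by
    have := tendsto_measure_cthickening_of_isCompact (μ := volume) hK
    rw [measure_mono_null hKA hvA] at this
    exact this.mono_left nhdsWithin_le_nhds
  filter_upwards [self_mem_nhdsWithin, (ENNReal.tendsto_nhds_zero.1 hKv) (δ / 2)
    (ENNReal.half_pos hδ.ne')] with ε hε hεK
  have hm := hρ ε hε
  calc ∫⁻ x, min 1 (∫⁻ y, ENNReal.ofReal (ρ ε (x - y)) ∂s)
      ≤ ∫⁻ x, ((Metric.cthickening ε K).indicator 1 x +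
          ∫⁻ y, ENNReal.ofReal (ρ ε (x - y)) * 1 ∂(s.restrict Kᶜ)) := by
        refine lintegral_mono fun x => ?_
        by_cases hx : x ∈ Metric.cthickening ε K
        · simp [hx]
        · refine (min_le_right _ _).trans (le_add_left ?_)
          have h0 : ∫⁻ y in K, ENNReal.ofReal (ρ ε (x - y)) ∂s = 0 := by
            rw [setLIntegral_congr_fun hK.measurableSet (g := fun _ => 0), lintegral_zero]
            intro y hy
            refine ENNReal.ofReal_eq_zero.2 (hm.eq_zero _ ?_).le
            by_contra hlt
            refine hx (Metric.mem_cthickening_of_dist_le x y ε K hy ?_)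
            rw [dist_eq_norm]
            exact (not_le.1 hlt).le
          simp only [mul_one]
          rw [← lintegral_add_compl _ hK.measurableSet, h0, zero_add]
    _ = volume (Metric.cthickening ε K) + s Kᶜ := by
        rw [lintegral_add_left (measurable_one.indicator Metric.isClosed_cthickening.measurableSet),
          hm.lintegral_lintegral _ aemeasurable_const,
          lintegral_indicator_one Metric.isClosed_cthickening.measurableSet]
        simp
    _ ≤ δ / 2 + δ / 2 := add_le_add hεK hsK
    _ = δ := ENNReal.add_halves δ

/-- The mollifications of `s` converge to `s` when tested against functions that are continuous
`s`-almost everywhere. -/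
theorem tendsto_integral_mollify_mul (hρ : ∀ ε, 0 < ε → IsMollifier (ρ ε) ε)
    {H : EuclideanSpace ℝ (Fin N) → ℝ} (hH : Integrable H)
    {C : ℝ} (hC : ∀ x, ‖H x‖ ≤ C) (hc : ∀ᵐ y ∂s, ContinuousAt H y) :
    Tendsto (fun ε => ∫ x, (∫ y, ρ ε (x - y) ∂s) * H x) (𝓝[>] 0) (𝓝 (∫ y, H y ∂s)) := by
  have hsmul : ∀ ε, 0 < ε → ∀ y, Integrable fun x => ρ ε (x - y) * H x := by
    intro ε hε y
    obtain ⟨D, hD⟩ := (hρ ε hε).exists_bound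
    exact hH.bdd_smul D
      ((hρ ε hε).continuous.comp (continuous_id.sub continuous_const)).aestronglyMeasurable
      (Eventually.of_forall fun _ => hD _)
  have hprod : ∀ ε, 0 < ε →
      Integrable (Function.uncurry fun x y => ρ ε (x - y) * H x) (volume.prod s) := by
    intro ε hε
    obtain ⟨D, hD⟩ := (hρ ε hε).exists_bound
    have h1 : Integrable (fun z : EuclideanSpace ℝ (Fin N) × EuclideanSpace ℝ (Fin N) => H z.1)
        (volume.prod s) := hH.comp_fst s
    exact h1.bdd_smul D
      ((hρ ε hε).continuous.comp (continuous_fst.sub continuous_snd)).aestronglyMeasurable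
      (Eventually.of_forall fun _ => hD _)
  have hswap : ∀ ε, 0 < ε → ∫ x, (∫ y, ρ ε (x - y) ∂s) * H x =
      ∫ y, (∫ x, ρ ε (x - y) * H x) ∂s := by
    intro ε hε
    rw [← integral_integral_swap (hprod ε hε)]
    simp only [integral_mul_const]
  have hlim : Tendsto (fun ε => ∫ y, (∫ x, ρ ε (x - y) * H x) ∂s) (𝓝[>] 0) (𝓝 (∫ y, H y ∂s)) := by
    refine tendsto_integral_filter_of_dominated_convergence (fun _ => C) ?_ ?_
      (integrable_const C) ?_
    · filter_upwards [self_mem_nhdsWithin] with ε hε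
      exact (hprod ε hε).integral_prod_right.1
    · filter_upwards [self_mem_nhdsWithin] with ε hε
      refine Eventually.of_forall fun y => ?_
      have h1 : Integrable fun x => ρ ε (x - y) := (hρ ε hε).integrable.comp_sub_right y
      refine (norm_integral_le_of_norm_le (h1.mul_const C) (Eventually.of_forall fun x => ?_)).trans
        (by rw [integral_mul_const, (hρ ε hε).integral_sub_right, one_mul])
      rw [norm_mul, Real.norm_of_nonneg ((hρ ε hε).nonneg _)]
      exact mul_le_mul_of_nonneg_left (hC x) ((hρ ε hε).nonneg _)
    · filter_upwards [hc] with y hy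
      rw [Metric.tendsto_nhds]
      intro δ hδ
      obtain ⟨r, hr, hball⟩ := Metric.continuousAt_iff.1 hy (δ / 2) (by positivity)
      filter_upwards [self_mem_nhdsWithin, nhdsWithin_le_nhds (Iio_mem_nhds hr)] with ε hε hεr
      have h1 : Integrable fun x => ρ ε (x - y) := (hρ ε hε).integrable.comp_sub_right y
      have h2 : (∫ x, ρ ε (x - y) * H x) - H y = ∫ x, ρ ε (x - y) * (H x - H y) := by
        simp only [mul_sub]
        rw [integral_sub (hsmul ε hε y) (h1.mul_const _), integral_mul_const,
          (hρ ε hε).integral_sub_right, one_mul]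
      rw [dist_eq_norm, h2]
      have h3 : ∫ x, ρ ε (x - y) * (δ / 2) = δ / 2 := by
        rw [integral_mul_const, (hρ ε hε).integral_sub_right, one_mul]
      refine (norm_integral_le_of_norm_le (h1.mul_const (δ / 2))
        (Eventually.of_forall fun x => ?_)).trans_lt (h3.trans_lt (by linarith))
      rw [norm_mul, Real.norm_of_nonneg ((hρ ε hε).nonneg _)]
      rcases lt_or_ge ‖x - y‖ ε with hx | hx
      · refine mul_le_mul_of_nonneg_left ?_ ((hρ ε hε).nonneg _)
        have := hball (x := x) (by rw [dist_eq_norm]; exact hx.trans hεr)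
        rw [dist_eq_norm] at this
        exact this.le
      · simp [(hρ ε hε).eq_zero _ hx]
  refine hlim.congr' ?_
  filter_upwards [self_mem_nhdsWithin] with ε hε using (hswap ε hε).symm

end Limits

end AreaStrict

/-! ### Continuity for a positive measure with a density -/

namespace AreaStrict

/-- For a positively homogeneous `G` at bounded distance from `g`, the increment of `g` along a
ray is that of `G` up to an error which is bounded, and small for small steps. -/
theorem abs_increment_sub_le {F : Type*} [NormedAddCommGroup F] [NormedSpace ℝ F] {g G : F → ℝ}
    {K : NNReal} (hg : LipschitzWith K g) (hG : LipschitzWith K G)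
    (hhom : ∀ t : ℝ, 0 ≤ t → ∀ p, G (t • p) = t * G p) {M R : ℝ} (hM : ∀ p, |g p - G p| ≤ M)
    {p : F} (hp : ‖p‖ ≤ R) {t : ℝ} (ht : 0 ≤ t) :
    |g ((1 + t) • p) - g p - t * G p| ≤ max (2 * M) (2 * K * R) * min 1 t := by
  rcases le_total 1 t with h1 | h1
  · rw [min_eq_left h1, mul_one]
    refine le_max_of_le_left ?_
    have h2 := hM ((1 + t) • p)
    rw [hhom _ (by linarith)] at h2
    have h3 := hM p
    calc |g ((1 + t) • p) - g p - t * G p|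
        = |(g ((1 + t) • p) - (1 + t) * G p) - (g p - G p)| := by ring_nf
      _ ≤ |g ((1 + t) • p) - (1 + t) * G p| + |g p - G p| := abs_sub _ _
      _ ≤ 2 * M := by linarith
  · rw [min_eq_right h1]
    have h2 := hg.dist_le_mul ((1 + t) • p) p
    have h3 : dist ((1 + t) • p) p = t * ‖p‖ := by
      rw [dist_eq_norm, add_smul, one_smul, add_sub_cancel_left, norm_smul, Real.norm_of_nonneg ht]
    have h4 := hG.dist_le_mul (t • p) 0
    have h5 : G 0 = 0 := by simpa using hhom 0 le_rfl 0
    rw [h3, Real.dist_eq] at h2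
    rw [h5, hhom t ht, Real.dist_eq, sub_zero, dist_zero_right, norm_smul,
      Real.norm_of_nonneg ht] at h4
    have h6 : (K : ℝ) * (t * ‖p‖) ≤ K * (t * R) := by gcongr
    calc |g ((1 + t) • p) - g p - t * G p|
        ≤ |g ((1 + t) • p) - g p| + |t * G p| := abs_sub _ _
      _ ≤ (2 * K * R) * t := by linarith
      _ ≤ max (2 * M) (2 * K * R) * t := by gcongr; exact le_max_right _ _

/-- Freezing at `x` a uniformly continuous approximation `k` of the density. -/
theorem IsMollifier.enorm_integral_sub_le {N : ℕ} {ρ : EuclideanSpace ℝ (Fin N) → ℝ} {ε : ℝ}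
    (hρ : IsMollifier ρ ε) {F : Type*} [NormedAddCommGroup F] [NormedSpace ℝ F] [CompleteSpace F]
    {σ : Measure (EuclideanSpace ℝ (Fin N))} [IsFiniteMeasure σ]
    {h k : EuclideanSpace ℝ (Fin N) → F} (hh : Integrable h σ) {η : ℝ}
    {x : EuclideanSpace ℝ (Fin N)} (hk : ∀ y, dist x y < ε → ‖k y - k x‖ ≤ η) :
    ‖(∫ y, ρ (x - y) • h y ∂σ) - (∫ y, ρ (x - y) ∂σ) • k x‖ₑ ≤
      ∫⁻ y, ENNReal.ofReal (ρ (x - y)) * ‖h y - k y‖ₑ ∂σ +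
        ENNReal.ofReal η * ∫⁻ y, ENNReal.ofReal (ρ (x - y)) ∂σ := by
  have hi := hρ.integrable_sub_left σ x
  have hm : AEMeasurable (fun y => ENNReal.ofReal (ρ (x - y))) σ :=
    hi.1.aemeasurable.ennreal_ofReal
  have h1 : (∫ y, ρ (x - y) • h y ∂σ) - (∫ y, ρ (x - y) ∂σ) • k x =
      ∫ y, ρ (x - y) • (h y - k x) ∂σ := by
    simp only [smul_sub]
    rw [integral_sub (hρ.integrable_smul hh x) (hi.smul_const _), integral_smul_const]
  rw [h1, ← lintegral_const_mul'' _ hm]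
  refine (enorm_integral_le_lintegral_enorm _).trans ?_
  rw [← lintegral_add_right' _ (hm.const_mul _)]
  refine lintegral_mono fun y => ?_
  rw [enorm_smul, Real.enorm_of_nonneg (hρ.nonneg _), mul_comm (ENNReal.ofReal η), ← mul_add]
  rcases lt_or_ge (dist x y) ε with hy | hy
  · gcongr
    calc ‖h y - k x‖ₑ = ‖(h y - k y) + (k y - k x)‖ₑ := by rw [sub_add_sub_cancel]
      _ ≤ ‖h y - k y‖ₑ + ‖k y - k x‖ₑ := enorm_add_le _ _
      _ ≤ ‖h y - k y‖ₑ + ENNReal.ofReal η := by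
        gcongr
        rw [← ofReal_norm]
        exact ENNReal.ofReal_le_ofReal (hk y hy)
  · rw [dist_eq_norm] at hy
    simp [hρ.eq_zero _ hy]

theorem IsMollifier.integral_restrict_eq_one {N : ℕ} {ρ : EuclideanSpace ℝ (Fin N) → ℝ} {ε : ℝ}
    (hρ : IsMollifier ρ ε) {U : Set (EuclideanSpace ℝ (Fin N))} {x : EuclideanSpace ℝ (Fin N)}
    (hx : Metric.ball x ε ⊆ U) : ∫ y in U, ρ (x - y) = 1 := by
  rw [setIntegral_eq_integral_of_forall_compl_eq_zero, hρ.integral_sub_left]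
  intro y hy
  refine hρ.eq_zero _ (not_lt.1 fun hlt => hy (hx ?_))
  rwa [Metric.mem_ball, dist_comm, dist_eq_norm]

theorem integrable_lipschitzWith_comp {X F : Type*} [MeasurableSpace X] [NormedAddCommGroup F]
    {κ : Measure X} [IsFiniteMeasure κ] {f : F → ℝ} {K : NNReal} (hf : LipschitzWith K f)
    {h : X → F} (hh : Integrable h κ) : Integrable (fun x => f (h x)) κ := by
  refine Integrable.mono' ((integrable_const |f 0|).add (hh.norm.const_mul K))
    (hf.continuous.comp_aestronglyMeasurable hh.1) (Eventually.of_forall fun x => ?_)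
  have h1 := hf.dist_le_mul (h x) 0
  rw [dist_zero_right, Real.dist_eq] at h1
  have h2 := abs_sub_abs_le_abs_sub (f (h x)) (f 0)
  simp only [Pi.add_apply, Real.norm_eq_abs]
  linarith

section Core

variable {N : ℕ} {F : Type*} [NormedAddCommGroup F]
  {g G : F → ℝ} {K : NNReal}
  {ρ : ℝ → EuclideanSpace ℝ (Fin N) → ℝ} {U Ω : Set (EuclideanSpace ℝ (Fin N))}
  {s : Measure (EuclideanSpace ℝ (Fin N))} [IsFiniteMeasure s]

/-- The limit of the frozen functional. The mass of `∂Ω` must vanish because the test function is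
cut off at `Ω`. -/
theorem tendsto_setIntegral_freeze (hg : Continuous g) (hG : Continuous G)
    (hρ : ∀ ε, 0 < ε → IsMollifier (ρ ε) ε)
    (hΩm : MeasurableSet Ω) (hΩ : IsCompact (closure Ω)) (hΩs : s (frontier Ω) = 0)
    {k : EuclideanSpace ℝ (Fin N) → F} (hk : Continuous k) (hkc : HasCompactSupport k) :
    Tendsto (fun ε => ∫ x in Ω, (g (k x) + (∫ y, ρ ε (x - y) ∂s) * G (k x))) (𝓝[>] 0)
      (𝓝 ((∫ x in Ω, g (k x)) + ∫ x in Ω, G (k x) ∂s)) := by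
  have hint : ∀ f : EuclideanSpace ℝ (Fin N) → ℝ, Continuous f → IntegrableOn f Ω := fun f hf =>
    (hf.continuousOn.integrableOn_compact hΩ).mono_set subset_closure
  obtain ⟨C, hC⟩ := hkc.isCompact_range hk |>.image hG |>.isBounded.exists_norm_le
  have hC' : ∀ x, ‖G (k x)‖ ≤ C := fun x => hC _ ⟨_, ⟨x, rfl⟩, rfl⟩
  have hlim := tendsto_integral_mollify_mul (s := s) hρ (H := Ω.indicator fun x => G (k x))
    ((hint _ (hG.comp hk)).integrable_indicator hΩm) (C := C)
    (fun x => (norm_indicator_le_norm_self _ _).trans (hC' x)) (by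
      filter_upwards [measure_eq_zero_iff_ae_notMem.1 hΩs] with y hy
      exact (hG.comp hk).continuousOn.continuousAt_indicator hy)
  rw [integral_indicator hΩm] at hlim
  refine (hlim.const_add (∫ x in Ω, g (k x))).congr' ?_
  filter_upwards [self_mem_nhdsWithin] with ε hε
  have hc : Continuous fun x => ∫ y, ρ ε (x - y) ∂s := by
    simpa using (hρ ε hε).continuous_convolution (κ := s) (f := fun _ => (1 : ℝ))
      (integrable_const 1)
  have i1 : IntegrableOn (fun x => g (k x)) Ω := hint _ (hg.comp hk)
  have i2 : IntegrableOn (fun x => (∫ y, ρ ε (x - y) ∂s) * G (k x)) Ω :=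
    hint _ (hc.mul (hG.comp hk))
  rw [integral_add i1 i2, ← integral_indicator hΩm
    (f := fun x => (∫ y, ρ ε (x - y) ∂s) * G (k x))]
  congr 2
  ext x
  by_cases hx : x ∈ Ω <;> simp [hx]

variable [NormedSpace ℝ F] [CompleteSpace F]

/-- Replacing, inside `g`, the mollified measure by the frozen approximation of its density. -/
theorem lintegral_enorm_sub_freeze_le (hg : LipschitzWith K g) (hG : LipschitzWith K G)
    (hhom : ∀ t : ℝ, 0 ≤ t → ∀ p, G (t • p) = t * G p) {M : ℝ} (hM : ∀ p, |g p - G p| ≤ M)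
    {ρ : EuclideanSpace ℝ (Fin N) → ℝ} {ε : ℝ} (hρ : IsMollifier ρ ε)
    (hUb : Bornology.IsBounded U) (hΩm : MeasurableSet Ω) (hΩU : ∀ x ∈ Ω, Metric.ball x ε ⊆ U)
    {h k : EuclideanSpace ℝ (Fin N) → F} (hh : Integrable h (volume.restrict U + s))
    (hk : Integrable k (volume.restrict U + s))
    {R η : ℝ} (hR : ∀ x, ‖k x‖ ≤ R) (hη : ∀ x y, dist x y < ε → ‖k y - k x‖ ≤ η) :
    ∫⁻ x in Ω, ‖g (∫ y, ρ (x - y) • h y ∂(volume.restrict U + s)) -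
        (g (k x) + (∫ y, ρ (x - y) ∂s) * G (k x))‖ₑ ≤
      K * (∫⁻ y, ‖h y - k y‖ₑ ∂(volume.restrict U + s) +
        ENNReal.ofReal η * (volume.restrict U + s) Set.univ) +
      ENNReal.ofReal (max (2 * M) (2 * K * R)) *
        ∫⁻ x, min 1 (∫⁻ y, ENNReal.ofReal (ρ (x - y)) ∂s) := by
  have : IsFiniteMeasure (volume.restrict U) := ⟨by simpa using hUb.measure_lt_top⟩
  set σ := volume.restrict U + s with hσ
  have hw : AEMeasurable (fun y => ‖h y - k y‖ₑ) σ := (hh.sub hk).1.enorm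
  have hm1 : AEMeasurable (fun x => ∫⁻ y, ENNReal.ofReal (ρ (x - y)) * ‖h y - k y‖ₑ ∂σ)
      (volume : Measure (EuclideanSpace ℝ (Fin N))) :=
    (hρ.measurable_uncurry.aemeasurable.mul hw.comp_snd).lintegral_prod_right'
  have hm2 : Measurable fun x => ∫⁻ y, ENNReal.ofReal (ρ (x - y)) ∂σ :=
    hρ.measurable_uncurry.lintegral_prod_right'
  have hm3 : Measurable fun x => min 1 (∫⁻ y, ENNReal.ofReal (ρ (x - y)) ∂s) :=
    measurable_const.min hρ.measurable_uncurry.lintegral_prod_right'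
  have hpt : ∀ x ∈ Ω, ‖g (∫ y, ρ (x - y) • h y ∂σ) -
      (g (k x) + (∫ y, ρ (x - y) ∂s) * G (k x))‖ₑ ≤
      K * (∫⁻ y, ENNReal.ofReal (ρ (x - y)) * ‖h y - k y‖ₑ ∂σ +
        ENNReal.ofReal η * ∫⁻ y, ENNReal.ofReal (ρ (x - y)) ∂σ) +
      ENNReal.ofReal (max (2 * M) (2 * K * R)) *
        min 1 (∫⁻ y, ENNReal.ofReal (ρ (x - y)) ∂s) := by
    intro x hx
    set t := ∫ y, ρ (x - y) ∂s with ht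
    have ht0 : 0 ≤ t := integral_nonneg fun _ => hρ.nonneg _
    have hmass : ∫ y, ρ (x - y) ∂σ = 1 + t := by
      rw [hσ, integral_add_measure (hρ.integrable_sub_left _ x) (hρ.integrable_sub_left _ x),
        hρ.integral_restrict_eq_one (hΩU x hx)]
    have h1 := hρ.enorm_integral_sub_le hh (k := k) (hη x)
    rw [hmass] at h1
    set m := ∫ y, ρ (x - y) • h y ∂σ
    have h2 : ‖g m - g ((1 + t) • k x)‖ₑ ≤ K * ‖m - (1 + t) • k x‖ₑ := by
      simpa [edist_eq_enorm_sub] using hg m ((1 + t) • k x)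
    have h3 : ‖g ((1 + t) • k x) - g (k x) - t * G (k x)‖ₑ ≤
        ENNReal.ofReal (max (2 * M) (2 * K * R)) *
        min 1 (∫⁻ y, ENNReal.ofReal (ρ (x - y)) ∂s) := by
      have h4 := abs_increment_sub_le hg hG hhom hM (hR x) ht0
      have hnn : 0 ≤ max (2 * M) (2 * K * R) :=
        le_max_of_le_left (by linarith [(abs_nonneg _).trans (hM 0)])
      rw [← hρ.ofReal_integral, ← ENNReal.ofReal_one, ← ENNReal.ofReal_min, ← ENNReal.ofReal_mul hnn,
        ← ofReal_norm]
      exact ENNReal.ofReal_le_ofReal h4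
    calc ‖g m - (g (k x) + t * G (k x))‖ₑ
        = ‖(g m - g ((1 + t) • k x)) + (g ((1 + t) • k x) - g (k x) - t * G (k x))‖ₑ := by
          congr 1; ring
      _ ≤ _ := (enorm_add_le _ _).trans (add_le_add (h2.trans (by gcongr)) h3)
  refine (setLIntegral_mono_ae' hΩm (Eventually.of_forall hpt)).trans
    ((setLIntegral_le_lintegral _ _).trans_eq ?_)
  have hmass := hρ.lintegral_lintegral σ (w := fun _ => 1) aemeasurable_const
  simp only [mul_one, lintegral_const, one_mul] at hmass
  have hm12 := hm1.add (hm2.const_mul (ENNReal.ofReal η)).aemeasurable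
  simp only [Pi.add_def] at hm12
  rw [lintegral_add_right _ (hm3.const_mul _), lintegral_const_mul _ hm3,
    lintegral_const_mul'' _ hm12,
    lintegral_add_right _ (hm2.const_mul _), lintegral_const_mul _ hm2, hmass,
    hρ.lintegral_lintegral σ hw]

/-- Continuity along mollification for a positive measure `1_U dx + s` with `s` singular and a
density `h`: the limit sees `g` on the absolutely continuous part and `G` on the singular part. -/
theorem tendsto_setIntegral_mollify (hg : LipschitzWith K g) (hG : LipschitzWith K G)
    (hhom : ∀ t : ℝ, 0 ≤ t → ∀ p, G (t • p) = t * G p) {M : ℝ} (hM : ∀ p, |g p - G p| ≤ M)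
    (hρ : ∀ ε, 0 < ε → IsMollifier (ρ ε) ε) (hU : IsOpen U) (hUb : Bornology.IsBounded U)
    (hΩm : MeasurableSet Ω) (hΩ : IsCompact (closure Ω)) (hΩU : closure Ω ⊆ U)
    (hΩs : s (frontier Ω) = 0) (hs : s ⟂ₘ volume)
    {h : EuclideanSpace ℝ (Fin N) → F} (hh : Integrable h (volume.restrict U + s)) :
    Tendsto (fun ε => ∫ x in Ω, g (∫ y, ρ ε (x - y) • h y ∂(volume.restrict U + s))) (𝓝[>] 0)
      (𝓝 ((∫ x in Ω, g (h x)) + ∫ x in Ω, G (h x) ∂s)) := by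
  have : IsFiniteMeasure (volume.restrict U) := ⟨by simpa using hUb.measure_lt_top⟩
  have hint : ∀ f : EuclideanSpace ℝ (Fin N) → ℝ, Continuous f → IntegrableOn f Ω := fun f hf =>
    (hf.continuousOn.integrableOn_compact hΩ).mono_set subset_closure
  have hΩU' : Ω ⊆ U := subset_closure.trans hΩU
  have hvΩ : volume.restrict Ω ≤ volume.restrict U := Measure.restrict_mono hΩU' le_rfl
  set V := (volume.restrict U + s).real Set.univ with hV
  have hV0 : 0 ≤ V := measureReal_nonneg
  suffices H : ∀ δ : ℝ, 0 < δ → ∀ᶠ ε in 𝓝[>] (0 : ℝ),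
      dist (∫ x in Ω, g (∫ y, ρ ε (x - y) • h y ∂(volume.restrict U + s)))
        ((∫ x in Ω, g (h x)) + ∫ x in Ω, G (h x) ∂s) ≤ (K * (2 + V) + 2) * δ by
    rw [Metric.tendsto_nhds]
    intro τ hτ
    have hD : 0 < K * (2 + V) + 2 := by positivity
    filter_upwards [H (τ / 2 / (K * (2 + V) + 2)) (by positivity)] with ε hε
    refine hε.trans_lt ?_
    rw [mul_div_cancel₀ _ hD.ne']
    linarith
  intro δ hδ
  obtain ⟨k, hkc, hkδ, hk, hki⟩ := hh.exists_hasCompactSupport_integral_sub_le hδ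
  obtain ⟨R, hR⟩ := hk.bounded_above_of_compact_support hkc
  obtain ⟨r, hr, hkr⟩ := Metric.uniformContinuous_iff.1 (hkc.uniformContinuous_of_continuous hk) δ hδ
  obtain ⟨r', hr', hr'U⟩ := hΩ.exists_thickening_subset_open hU hΩU
  have hfreeze := tendsto_setIntegral_freeze hg.continuous hG.continuous hρ hΩm hΩ hΩs hk hkc
  have hmin : Tendsto (fun ε => ENNReal.ofReal (max (2 * M) (2 * K * R)) *
      ∫⁻ x, min 1 (∫⁻ y, ENNReal.ofReal (ρ ε (x - y)) ∂s)) (𝓝[>] 0) (𝓝 0) := by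
    have := ENNReal.Tendsto.const_mul (a := ENNReal.ofReal (max (2 * M) (2 * K * R)))
      (tendsto_lintegral_min_one hρ hs) (Or.inr ENNReal.ofReal_ne_top)
    rwa [mul_zero] at this
  -- the limit functional at `k` and at `h` differ by at most the `L¹` distance
  have hkL : dist ((∫ x in Ω, g (k x)) + ∫ x in Ω, G (k x) ∂s)
      ((∫ x in Ω, g (h x)) + ∫ x in Ω, G (h x) ∂s) ≤ K * δ := by
    have hsub := (hh.sub hki).norm
    have hsub1 : Integrable (fun x => ‖h x - k x‖) (volume.restrict U) := hsub.left_of_add_measure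
    have hsub2 : Integrable (fun x => ‖h x - k x‖) s := hsub.right_of_add_measure
    have aux : ∀ {κ : Measure (EuclideanSpace ℝ (Fin N))} [IsFiniteMeasure κ] {f : F → ℝ},
        LipschitzWith K f → Integrable h κ → Integrable k κ →
        dist (∫ x, f (k x) ∂κ) (∫ x, f (h x) ∂κ) ≤ K * ∫ x, ‖h x - k x‖ ∂κ := by
      intro κ _ f hf h1 h2
      rw [dist_eq_norm, ← integral_sub (integrable_lipschitzWith_comp hf h2)
        (integrable_lipschitzWith_comp hf h1),
        ← integral_const_mul]
      refine norm_integral_le_of_norm_le ((h1.sub h2).norm.const_mul _)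
        (Eventually.of_forall fun x => ?_)
      rw [← dist_eq_norm, ← dist_eq_norm, dist_comm (h x)]
      exact hf.dist_le_mul _ _
    have : IsFiniteMeasure (volume.restrict Ω) := isFiniteMeasure_of_le _ hvΩ
    have a1 := aux (κ := volume.restrict Ω) hg (hh.left_of_add_measure.mono_measure hvΩ)
      (hki.left_of_add_measure.mono_measure hvΩ)
    have a2 := aux (κ := s.restrict Ω) hG hh.right_of_add_measure.integrableOn
      hki.right_of_add_measure.integrableOn
    have a3 : ∫ x in Ω, ‖h x - k x‖ ≤ ∫ x in U, ‖h x - k x‖ :=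
      integral_mono_measure hvΩ (Eventually.of_forall fun _ => norm_nonneg _) hsub1
    have a4 : ∫ x in Ω, ‖h x - k x‖ ∂s ≤ ∫ x, ‖h x - k x‖ ∂s :=
      integral_mono_measure Measure.restrict_le_self (Eventually.of_forall fun _ => norm_nonneg _)
        hsub2
    rw [integral_add_measure hsub1 hsub2] at hkδ
    calc _ ≤ _ := dist_add_add_le _ _ _ _
      _ ≤ K * (∫ x in Ω, ‖h x - k x‖) + K * ∫ x in Ω, ‖h x - k x‖ ∂s := add_le_add a1 a2
      _ = K * ((∫ x in Ω, ‖h x - k x‖) + ∫ x in Ω, ‖h x - k x‖ ∂s) := by ring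
      _ ≤ K * δ := by gcongr; linarith
  filter_upwards [self_mem_nhdsWithin, nhdsWithin_le_nhds (Iio_mem_nhds hr),
    nhdsWithin_le_nhds (Iio_mem_nhds hr'), Metric.tendsto_nhds.1 hfreeze δ hδ,
    (ENNReal.tendsto_nhds_zero.1 hmin) (ENNReal.ofReal δ) (by simpa using hδ)]
    with ε hε hεr hεr' hε1 hε2
  have hΩε : ∀ x ∈ Ω, Metric.ball x ε ⊆ U := fun x hx y hy => hr'U <|
    Metric.mem_thickening_iff.2 ⟨x, subset_closure hx, (Metric.mem_ball.1 hy).trans hεr'⟩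
  have hle := lintegral_enorm_sub_freeze_le hg hG hhom hM (hρ ε hε) hUb hΩm hΩε hh hki hR (η := δ)
    (fun x y hxy => by
      rw [← dist_eq_norm, dist_comm]
      exact (hkr (hxy.trans hεr)).le)
  have hk' : ∫⁻ y, ‖h y - k y‖ₑ ∂(volume.restrict U + s) ≤ ENNReal.ofReal δ := by
    have := ofReal_integral_norm_eq_lintegral_enorm (hh.sub hki)
    simp only [Pi.sub_apply] at this
    rw [← this]
    exact ENNReal.ofReal_le_ofReal hkδ
  have hcm := (hρ ε hε).continuous_convolution hh
  have hcs : Continuous fun x => ∫ y, ρ ε (x - y) ∂s := by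
    simpa using (hρ ε hε).continuous_convolution (κ := s) (f := fun _ => (1 : ℝ))
      (integrable_const 1)
  have i1 : IntegrableOn (fun x => g (∫ y, ρ ε (x - y) • h y ∂(volume.restrict U + s))) Ω :=
    hint _ (hg.continuous.comp hcm)
  have i2 : IntegrableOn (fun x => g (k x) + (∫ y, ρ ε (x - y) ∂s) * G (k x)) Ω :=
    hint _ ((hg.continuous.comp hk).add (hcs.mul (hG.continuous.comp hk)))
  have hdist : dist (∫ x in Ω, g (∫ y, ρ ε (x - y) • h y ∂(volume.restrict U + s)))
      (∫ x in Ω, (g (k x) + (∫ y, ρ ε (x - y) ∂s) * G (k x))) ≤ K * (δ + δ * V) + δ := by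
    rw [dist_eq_norm, ← integral_sub i1 i2, ← ENNReal.ofReal_le_ofReal_iff (by positivity),
      ofReal_norm]
    refine (enorm_integral_le_lintegral_enorm _).trans (hle.trans ?_)
    rw [ENNReal.ofReal_add (by positivity) hδ.le, ENNReal.ofReal_mul K.coe_nonneg,
      ENNReal.ofReal_add hδ.le (by positivity), ENNReal.ofReal_mul hδ.le, hV, ofReal_measureReal,
      ENNReal.ofReal_coe_nnreal]
    gcongr
  calc _ ≤ _ := dist_triangle4 _ _ _ _
    _ ≤ (K * (δ + δ * V) + δ) + δ + K * δ := add_le_add (add_le_add hdist hε1.le) hkL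
    _ = (K * (2 + V) + 2) * δ := by ring

end Core

end AreaStrict

/-! ### From the open set to the whole space -/

namespace AreaStrict

theorem isMollifier_scaledKernel {N : ℕ} {φ : EuclideanSpace ℝ (Fin N) → ℝ}
    (hφ : Continuous φ) (hφ_nonneg : ∀ x, 0 ≤ φ x) (hφ_supp : tsupport φ ⊆ Metric.ball 0 1)
    (hφ_int : ∫ x, φ x = 1) {ε : ℝ} (hε : 0 < ε) : IsMollifier (scaledKernel φ ε) ε where
  continuous := (hφ.comp (continuous_const_smul _)).const_mul _
  nonneg x := mul_nonneg (by positivity) (hφ_nonneg _)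
  eq_zero x hx := by
    have h : φ (ε⁻¹ • x) = 0 := by
      refine image_eq_zero_of_notMem_tsupport fun hmem => ?_
      have h1 := hφ_supp hmem
      rw [mem_ball_zero_iff, norm_smul, norm_inv, Real.norm_of_nonneg hε.le,
        inv_mul_lt_iff₀ hε, mul_one] at h1
      exact absurd hx (not_le.2 h1)
    simp [scaledKernel, h]
  integral_eq_one := by
    simp only [scaledKernel]
    rw [integral_const_mul, Measure.integral_comp_inv_smul_of_nonneg _ _ hε.le, hφ_int]
    simp [(pow_pos hε N).ne']

section Subtype

variable {N : ℕ} {U : Set (EuclideanSpace ℝ (Fin N))}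

theorem map_lebesgueOn (hU : MeasurableSet U) :
    (lebesgueOn U).map Subtype.val = volume.restrict U :=
  map_comap_subtype_coe hU volume

theorem isFiniteMeasure_lebesgueOn (hU : MeasurableSet U) (hUb : Bornology.IsBounded U) :
    IsFiniteMeasure (lebesgueOn U) := by
  refine ⟨?_⟩
  have h := congrArg (fun m : Measure (EuclideanSpace ℝ (Fin N)) => m Set.univ) (map_lebesgueOn hU)
  simp only [Measure.restrict_apply_univ] at h
  rw [(MeasurableEmbedding.subtype_coe hU).map_apply, Set.preimage_univ] at h
  rw [h]
  exact hUb.measure_lt_top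

theorem map_mutuallySingular_volume (hU : MeasurableSet U) {s : Measure U}
    (hs : s ⟂ₘ lebesgueOn U) : s.map Subtype.val ⟂ₘ volume := by
  have e := MeasurableEmbedding.subtype_coe hU
  obtain ⟨A, hA, hsA, hκA⟩ := hs
  refine Measure.MutuallySingular.symm ⟨Subtype.val '' Aᶜ, e.measurableSet_image.2 hA.compl, ?_, ?_⟩
  · rwa [lebesgueOn, e.comap_apply] at hκA
  · rw [e.map_apply, Set.preimage_compl, Set.preimage_image_eq _ Subtype.val_injective, compl_compl]
    exact hsA

end Subtype

end AreaStrict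

theorem theorem3 {N d : ℕ} (U : Set (EuclideanSpace ℝ (Fin N)))
    (hU : IsOpen U) (hUb : Bornology.IsBounded U)
    -- a finite `ℝ^d`-valued Radon (that is, countably additive Borel) measure on `U`
    (μ : VectorMeasure U (EuclideanSpace ℝ (Fin d)))
    -- the mollifier
    (φ : EuclideanSpace ℝ (Fin N) → ℝ) (hφ : ContDiff ℝ ∞ φ) (hφ_nonneg : ∀ x, 0 ≤ φ x)
    (hφ_supp : tsupport φ ⊆ Metric.ball 0 1) (hφ_int : ∫ x, φ x = 1)
    -- the integrand
    (g : EuclideanSpace ℝ (Fin d) → ℝ) (hg_conv : ConvexOn ℝ Set.univ g)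
    (hg_nonneg : ∀ p, 0 ≤ g p) (hg_growth : ∃ C : ℝ, 0 < C ∧ ∀ p, g p ≤ C * (1 + ‖p‖))
    (hg_rec : ∃ α : ℝ, 1 < α ∧ ∃ C : ℝ, 0 < C ∧
      ∀ p : EuclideanSpace ℝ (Fin d), ‖p‖ = 1 → ∀ t : ℝ, 0 < t →
        |g (t • p) / t - AreaStrict.recession g p| ≤ C / t ^ α)
    -- the set `Ω ⊂⊂ U`
    (Ω : Set (EuclideanSpace ℝ (Fin N))) (hΩ : IsCompact (closure Ω)) (hΩU : closure Ω ⊆ U)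
    (hΩ_vol : volume (frontier Ω) = 0)
    (hΩ_var : μ.variation ((↑) ⁻¹' frontier Ω : Set U) = 0) :
    (∀ ε : ℝ, 0 < ε → IntegrableOn (fun x => g (AreaStrict.mollify μ φ ε x)) Ω volume) ∧
    IntegrableOn (fun x : U => g (AreaStrict.density μ (AreaStrict.lebesgueOn U) x)) ((↑) ⁻¹' Ω)
      (AreaStrict.lebesgueOn U) ∧
    IntegrableOn
      (fun x : U => AreaStrict.recession g
        (AreaStrict.polar (AreaStrict.singularPart μ (AreaStrict.lebesgueOn U)) x))
      ((↑) ⁻¹' Ω) (AreaStrict.singularPart μ (AreaStrict.lebesgueOn U)).variation ∧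
    Tendsto (fun ε : ℝ => ∫ x in Ω, g (AreaStrict.mollify μ φ ε x)) (𝓝[>] 0)
      (𝓝 ((∫ x in ((↑) ⁻¹' Ω : Set U), g (AreaStrict.density μ (AreaStrict.lebesgueOn U) x)
          ∂(AreaStrict.lebesgueOn U)) +
        ∫ x in ((↑) ⁻¹' Ω : Set U),
          AreaStrict.recession g
            (AreaStrict.polar (AreaStrict.singularPart μ (AreaStrict.lebesgueOn U)) x)
            ∂(AreaStrict.singularPart μ (AreaStrict.lebesgueOn U)).variation)) := by
  have hUm := hU.measurableSet
  have e := MeasurableEmbedding.subtype_coe hUm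
  have := AreaStrict.isFiniteMeasure_lebesgueOn hUm hUb
  obtain ⟨C, hC, hgC⟩ := hg_growth
  lift C to NNReal using hC.le
  have hg := hg_conv.lipschitzWith_of_linear_growth hg_nonneg hgC
  have hlim := AreaStrict.tendsto_recession hg_rec
  have hG := AreaStrict.lipschitzWith_recession hlim hg
  obtain ⟨M, hM⟩ := AreaStrict.exists_abs_sub_recession_le hg_rec hg
  have hρ : ∀ ε, 0 < ε → AreaStrict.IsMollifier (AreaStrict.scaledKernel φ ε) ε := fun ε hε =>
    AreaStrict.isMollifier_scaledKernel hφ.continuous hφ_nonneg hφ_supp hφ_int hε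
  set κ := AreaStrict.lebesgueOn U with hκ
  set μs := AreaStrict.singularPart μ κ with hμs
  have := AreaStrict.isFiniteMeasure_variation μs
  obtain ⟨h, hi, h1, h2, hμ⟩ := AreaStrict.exists_density_add_variation_singularPart μ κ
  -- everything is transported to `ℝ^N`, extending the density by `0` outside `U`
  set s := μs.variation.map Subtype.val with hs
  have hmap : (κ + μs.variation).map Subtype.val = volume.restrict U + s := by
    rw [Measure.map_add _ _ e.measurable, AreaStrict.map_lebesgueOn hUm]
  set h' : EuclideanSpace ℝ (Fin N) → EuclideanSpace ℝ (Fin d) :=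
    Function.extend Subtype.val h 0 with hh'
  have hext : ∀ y : U, h' y = h y := fun y => Subtype.val_injective.extend_apply _ _ y
  have hi' : Integrable h' (volume.restrict U + s) := by
    rw [← hmap, e.integrable_map_iff]
    exact hi.congr (Eventually.of_forall fun y => (hext y).symm)
  have hmol : ∀ ε, 0 < ε → ∀ x, AreaStrict.mollify μ φ ε x =
      ∫ y, AreaStrict.scaledKernel φ ε (x - y) • h' y ∂(volume.restrict U + s) := by
    intro ε hε x
    obtain ⟨D, hD⟩ := (hρ ε hε).exists_bound
    have hsm : StronglyMeasurable fun y : U => AreaStrict.scaledKernel φ ε (x - y) :=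
      ((hρ ε hε).continuous.comp (continuous_const.sub continuous_subtype_val)).stronglyMeasurable
    rw [AreaStrict.mollify, ← hμ, AreaStrict.integral_withDensityᵥ hi hsm (fun y => hD _), ← hmap,
      e.integral_map]
    simp only [hext]
    rfl
  have hκfr : κ (Subtype.val ⁻¹' frontier Ω) = 0 := by
    rw [← e.map_apply, AreaStrict.map_lebesgueOn hUm]
    exact Measure.absolutelyContinuous_of_le Measure.restrict_le_self hΩ_vol
  have hsfr : s (frontier Ω) = 0 := by
    rw [hs, e.map_apply]
    exact AreaStrict.variation_singularPart_eq_zero (e.measurable isClosed_frontier.measurableSet)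
      hΩ_var hκfr
  have hsv : s ⟂ₘ volume := AreaStrict.map_mutuallySingular_volume hUm
    (AreaStrict.variation_singularPart_mutuallySingular μ κ)
  have hΩU' : Ω ⊆ U := subset_closure.trans hΩU
  -- `Ω` is measurable only up to null sets, its interior is Borel
  have hlim := AreaStrict.tendsto_setIntegral_mollify (Ω := interior Ω) hg hG
    (fun t ht p => AreaStrict.recession_smul hlim ht p) hM hρ hU hUb isOpen_interior.measurableSet
    (hΩ.of_isClosed_subset isClosed_closure (closure_mono interior_subset))
    ((closure_mono interior_subset).trans hΩU)
    (measure_mono_null frontier_interior_subset hsfr) hsv hi'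
  have hv := interior_ae_eq_of_null_frontier hΩ_vol
  have hvs := interior_ae_eq_of_null_frontier hsfr
  simp only [setIntegral_congr_set hv, setIntegral_congr_set hvs] at hlim
  have hac : ∫ x in (Subtype.val ⁻¹' Ω : Set U), g (AreaStrict.density μ κ x) ∂κ =
      ∫ x in Ω, g (h' x) := by
    rw [← Measure.restrict_restrict_of_subset hΩU', ← AreaStrict.map_lebesgueOn hUm,
      e.setIntegral_map]
    refine integral_congr_ae (ae_restrict_of_ae ?_)
    filter_upwards [h1] with x hx
    rw [hext, hx]
  have hsing : ∫ x in (Subtype.val ⁻¹' Ω : Set U),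
      AreaStrict.recession g (AreaStrict.polar μs x) ∂μs.variation =
      ∫ x in Ω, AreaStrict.recession g (h' x) ∂s := by
    rw [hs, e.setIntegral_map]
    refine integral_congr_ae (ae_restrict_of_ae ?_)
    filter_upwards [h2] with x hx
    rw [hext, hx]
  refine ⟨fun ε hε => ?_, ?_, ?_, ?_⟩
  · simp only [hmol ε hε]
    have hc := hg.continuous.comp ((hρ ε hε).continuous_convolution hi')
    exact (hc.continuousOn.integrableOn_compact hΩ).mono_set subset_closure
  · exact (AreaStrict.integrable_lipschitzWith_comp hg
      (AreaStrict.integrable_density μ κ)).integrableOn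
  · exact (AreaStrict.integrable_lipschitzWith_comp hG
      (AreaStrict.integrable_density μs μs.variation)).integrableOn
  · rw [hac, hsing]
    refine hlim.congr' ?_
    filter_upwards [self_mem_nhdsWithin] with ε hε
    simp only [hmol ε hε]
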